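/- Let $\Bbbk$ be a field and let $n\geqslant 1$, $d\geqslant 2$ be integers. Let $NC_A(n,d)$ be the unital associative $\Bbbk$-algebra generated by $T_1,\dots,T_n$ subject to the relations $$T_iT_{i+1}T_i=T_{i+1}T_iT_{i+1}\ (0<i<n),\qquad T_iT_j=T_jT_i\ (|i-j|>1),\qquad T_1^2=\cdots=T_{n-1}^2=T_n^d=0.$$ For $m\geqslant 0$ let $NC_A(n,d)_m$ be the $\Bbbk$-span of the words of length $m$ in $T_1,\dots,T_n$. Then these finite-dimensional subspaces form a grading $NC_A(n,d)=\bigoplus_{m\geqslant 0}NC_A(n,d)_m$ of the algebra, in which every $T_i$ has degree $1$, and the Hilbert--Poincaré series of this graded algebra is the polynomial $$\sum_{m\geqslant 0}\dim_\Bbbk\bigl(NC_A(n,d)_m\bigr)\,q^m=[n]_q!\,\bigl(1+q\,[n]_q\,[d-1]_q\bigr),$$ where $[j]_q:=\frac{q^j-1}{q-1}=1+q+\cdots+q^{j-1}$ and $[n]_q!:=\prod_{j=1}^n[j]_q$. -/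

import Mathlib

open scoped PowerSeries

/-- The defining relations of the generalized nil-Coxeter algebra `NC_A(n,d)` on the free
algebra with generators indexed by `Fin n`. The index `i : Fin n` stands for the
generator `T_{i+1}`, so the last generator `T_n` is the one with `i + 1 = n`. -/
inductive NilCoxeterRel (k : Type*) [CommRing k] (n d : ℕ) :
    FreeAlgebra k (Fin n) → FreeAlgebra k (Fin n) → Prop
  | braid (i j : Fin n) (h : (i : ℕ) + 1 = j) :
      NilCoxeterRel k n d
        (FreeAlgebra.ι k i * FreeAlgebra.ι k j * FreeAlgebra.ι k i)
        (FreeAlgebra.ι k j * FreeAlgebra.ι k i * FreeAlgebra.ι k j)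
  | comm (i j : Fin n) (h : (i : ℕ) + 1 < j) :
      NilCoxeterRel k n d
        (FreeAlgebra.ι k i * FreeAlgebra.ι k j)
        (FreeAlgebra.ι k j * FreeAlgebra.ι k i)
  | sq (i : Fin n) (h : (i : ℕ) + 1 < n) :
      NilCoxeterRel k n d (FreeAlgebra.ι k i ^ 2) 0
  | last (i : Fin n) (h : (i : ℕ) + 1 = n) :
      NilCoxeterRel k n d (FreeAlgebra.ι k i ^ d) 0

/-- The generalized nil-Coxeter algebra `NC_A(n,d)` over `k`. -/
abbrev NilCoxeterA (k : Type*) [CommRing k] (n d : ℕ) : Type _ :=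
  RingQuot (NilCoxeterRel k n d)

namespace NilCoxeterA

/-- The generators of `NC_A(n,d)`. -/
noncomputable def T (k : Type*) [CommRing k] (n d : ℕ) (i : Fin n) : NilCoxeterA k n d :=
  RingQuot.mkAlgHom k (NilCoxeterRel k n d) (FreeAlgebra.ι k i)

/-- The degree `m` part of `NC_A(n,d)`, with every generator in degree one: the span of the
words of length `m` in the generators. -/
noncomputable def degreePart (k : Type*) [CommRing k] (n d : ℕ) (m : ℕ) :
    Submodule k (NilCoxeterA k n d) :=
  Submodule.span k {x | ∃ l : List (Fin n), l.length = m ∧ x = (l.map (T k n d)).prod}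

end NilCoxeterA

/-- The Hilbert–Poincaré series `∑ m, dim (𝒜 m) q ^ m` of a family of subspaces. -/
noncomputable def hilbertPoincareSeries {k A : Type*} [Field k] [AddCommGroup A] [Module k A]
    (𝒜 : ℕ → Submodule k A) : ℤ⟦X⟧ :=
  PowerSeries.mk fun m => (Module.finrank k (𝒜 m) : ℤ)

/-- The `q`-integer `[n]_q = 1 + q + ⋯ + q ^ (n - 1)`, as a polynomial in `q`. -/
noncomputable def qInt (n : ℕ) : Polynomial ℤ :=
  ∑ i ∈ Finset.range n, Polynomial.X ^ i

/-- `[n]_q = (q ^ n - 1) / (q - 1)`. -/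
theorem qInt_mul_X_sub_one (n : ℕ) :
    qInt n * (Polynomial.X - 1) = Polynomial.X ^ n - 1 :=
  geom_sum_mul _ n

/-- The `q`-factorial `[n]_q! = ∏ j = 1, …, n, [j]_q`. -/
noncomputable def qFact (n : ℕ) : Polynomial ℤ :=
  ∏ j ∈ Finset.Icc 1 n, qInt j

/-! The proof exhibits a monomial basis. Index the generators as `t 0, …, t m`, with `n = m + 1` and
`d = e + 2`. The normal forms are the normal forms `w` in `t 0, …, t (m - 1)`, which satisfy the
relations with exponent 2, together with the words `t a ⋯ t (m - 1) * t m ^ (k + 1) * w` for `a ≤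
m`, `k ≤ e`. By recursion the `w` contribute `[m]!(1 + q[m]) = [m + 1]!` to the length count, and
the choice of nothing or of `(a, k)` contributes `1 + q[n][d - 1]`.

Spanning: a generator times a normal form is zero or a normal form one letter longer
(`NormalForms.mul_word_extend`).

Independence: the same multiplication rule, taken as partial maps on formal symbols, satisfies the
defining relations (`NilCoxeterAct.extend`). Its linearisation is a representation in which each
normal form sends the base vector to its own basis vector (`linearIndependent_word`). As lengths are
word lengths, the basis splits by degree. -/

/-! ### Relations and ascending products -/

/-- The relations of `NC_A(n,d)` for a sequence `t 0, …, t (n - 1)` in a monoid with zero. -/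
structure NilCoxeterSeq {R : Type*} [MonoidWithZero R] (t : ℕ → R) (n d : ℕ) : Prop where
  braid : ∀ i, i + 1 < n → t i * (t (i + 1) * t i) = t (i + 1) * (t i * t (i + 1))
  comm : ∀ i j, i + 1 < j → j < n → t i * t j = t j * t i
  sq : ∀ i, i + 1 < n → t i * t i = 0
  last : ∀ i, i + 1 = n → t i ^ d = 0

/-- The relations of `NC_A(n,d)` for a sequence of partial self-maps of a type. -/
structure NilCoxeterAct {X : Type*} (f : ℕ → X → Option X) (n d : ℕ) : Prop where
  braid : ∀ i, i + 1 < n → ∀ x,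
    ((f i x).bind (f (i + 1))).bind (f i) = ((f (i + 1) x).bind (f i)).bind (f (i + 1))
  comm : ∀ i j, i + 1 < j → j < n → ∀ x, (f i x).bind (f j) = (f j x).bind (f i)
  sq : ∀ i, i + 1 < n → ∀ x, (f i x).bind (f i) = none
  last : ∀ i, i + 1 = n → ∀ x, (fun o : Option X => o.bind (f i))^[d] (some x) = none

namespace NilCoxeterSeq

variable {R : Type*} [MonoidWithZero R] {t : ℕ → R}

/-- Without the last generator all remaining squares vanish, so the recursion passes through
exponent 2 whatever `d` is. -/
theorem restrict {m d : ℕ} (h : NilCoxeterSeq t (m + 1) d) : NilCoxeterSeq t m 2 where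
  braid i hi := h.braid i (by omega)
  comm i j hij hj := h.comm i j hij (by omega)
  sq i hi := h.sq i (by omega)
  last i hi := by rw [pow_two]; exact h.sq i (by omega)

/-- The ascending product `t a * t (a + 1) * ⋯ * t (b - 1)`. -/
def asc (t : ℕ → R) (a b : ℕ) : R := ((List.Ico a b).map t).prod

theorem asc_self (a : ℕ) : asc t a a = 1 := by simp [asc]

theorem asc_eq_mul {a b : ℕ} (h : a < b) : asc t a b = t a * asc t (a + 1) b := by
  simp [asc, List.Ico.eq_cons h]

theorem asc_succ {a b : ℕ} (h : a ≤ b) : asc t a (b + 1) = asc t a b * t b := by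
  simp [asc, List.Ico.succ_top h]

theorem asc_mul_asc {a b c : ℕ} (hab : a ≤ b) (hbc : b ≤ c) :
    asc t a b * asc t b c = asc t a c := by
  rw [asc, asc, asc, ← List.prod_append, ← List.map_append,
    List.Ico.append_consecutive hab hbc]

variable {n d : ℕ} (h : NilCoxeterSeq t n d)
include h

theorem commute {i j : ℕ} (hi : i < n) (hj : j < n) (hij : i + 1 < j ∨ j + 1 < i) :
    Commute (t i) (t j) := by
  rcases hij with hij | hij
  · exact h.comm i j hij hj
  · exact (h.comm j i hij hi).symm

theorem commute_asc {i a b : ℕ} (hi : i < n) (hb : b ≤ n) (hij : i + 1 < a ∨ b < i) :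
    Commute (t i) (asc t a b) := by
  refine Commute.list_prod_right _ _ ?_
  intro y hy
  obtain ⟨j, hj, rfl⟩ := List.mem_map.1 hy
  have := List.Ico.mem.1 hj
  exact h.commute hi (by omega) (by omega)

/-- `t i` commutes to the right until it meets `t (i - 1) * t i`; the braid relation turns it into
`t (i - 1)`, which commutes with the rest. -/
theorem mul_asc_of_mem {i a b : ℕ} (hai : a < i) (hib : i < b) (hb : b ≤ n) :
    t i * asc t a b = asc t a b * t (i - 1) := by
  obtain ⟨i, rfl⟩ : ∃ j, i = j + 1 := ⟨i - 1, by omega⟩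
  have e : asc t a b = asc t a i * (t i * (t (i + 1) * asc t (i + 2) b)) := by
    rw [← asc_eq_mul hib, ← asc_eq_mul (by omega), asc_mul_asc (by omega) (by omega)]
  have c1 := h.commute_asc (i := i + 1) (a := a) (b := i) (by omega) (by omega) (by omega)
  have c2 := h.commute_asc (i := i) (a := i + 2) (b := b) (by omega) (by omega) (by omega)
  have br := h.braid i (by omega)
  calc t (i + 1) * asc t a b
      = (t (i + 1) * asc t a i) * (t i * (t (i + 1) * asc t (i + 2) b)) := by
        rw [e, mul_assoc]
    _ = asc t a i * ((t (i + 1) * (t i * t (i + 1))) * asc t (i + 2) b) := by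
        rw [c1.eq]; simp only [mul_assoc]
    _ = asc t a i * (t i * (t (i + 1) * (t i * asc t (i + 2) b))) := by
        rw [← br]; simp only [mul_assoc]
    _ = asc t a b * t i := by rw [c2.eq, e]; simp only [mul_assoc]

omit h in
theorem mul_asc_self {a b : ℕ} (h : NilCoxeterSeq t n d) (hab : a < b) (hb : b < n) :
    t a * asc t a b = 0 := by
  rw [asc_eq_mul hab, ← mul_assoc, h.sq a (by omega), zero_mul]

end NilCoxeterSeq

/-- Together with `bind_some_eq`, this pulls the unchanged pair `(a, k)` out of a composite,
reducing relations for `extendAct` to those for `f`. -/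
theorem bind_map_eq {α β γ : Type*} (o : Option α) (g : α → Option β) (p : β → γ) :
    (o.bind fun a => (g a).map p) = (o.bind g).map p := by
  cases o <;> rfl

theorem bind_some_eq {α β : Type*} (o : Option α) (p : α → β) :
    (o.bind fun a => some (p a)) = o.map p := by
  cases o <;> rfl

/-! ### The action on formal normal forms and its relations -/

section Extend

variable {Y : Type} {m e : ℕ}

/-- Left multiplication by generators on normal forms: the pair `(y, none)` stands for `y` and
`(y, some (a, k))` for `t a * ⋯ * t (m - 1) * t m ^ (k + 1) * y`. -/
def extendAct (m e : ℕ) (f : ℕ → Y → Option Y) (i : ℕ) :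
    Y × Option (Fin (m + 1) × Fin (e + 1)) → Option (Y × Option (Fin (m + 1) × Fin (e + 1)))
  | (y, none) => if i = m then some (y, some (Fin.last m, 0)) else (f i y).map (·, none)
  | (y, some (a, k)) =>
    if i + 1 < a then (f i y).map (·, some (a, k))
    else if h : i + 1 = a then some (y, some (⟨i, by omega⟩, k))
    else if i = a then
      if h : a = m ∧ k < e then some (y, some (a, ⟨k + 1, by omega⟩)) else none
    -- Passing the ascending product lowers the index by one. For `i = m` this consumes a factor `t
    -- m` by a braid move; a second factor `t m` would then create `t (m - 1) * t (m - 1) = 0`.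
    else if i = m ∧ 0 < k.val then none else (f (i - 1) y).map (·, some (a, k))

variable {f : ℕ → Y → Option Y} {i a k : ℕ} (y : Y)

theorem extendAct_none_lt (h : i < m) :
    extendAct m e f i (y, none) = (f i y).map (·, none) := by
  simp [extendAct, h.ne]

theorem extendAct_none_last :
    extendAct m e f m (y, none) = some (y, some (⟨m, by omega⟩, ⟨0, by omega⟩)) := by
  simp [extendAct, Fin.last]

theorem extendAct_lt (ha : a < m + 1) (hk : k < e + 1) (h : i + 1 < a) :
    extendAct m e f i (y, some (⟨a, ha⟩, ⟨k, hk⟩)) =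
      (f i y).map (·, some (⟨a, ha⟩, ⟨k, hk⟩)) := by
  simp [extendAct, h]

theorem extendAct_pred (ha : a < m + 1) (hk : k < e + 1) (h : i + 1 = a) :
    extendAct m e f i (y, some (⟨a, ha⟩, ⟨k, hk⟩)) =
      some (y, some (⟨i, by omega⟩, ⟨k, hk⟩)) := by
  subst h; simp [extendAct]

theorem extendAct_self (ha : a < m + 1) (hk : k < e + 1) (h : i = a) (h' : a < m) :
    extendAct m e f i (y, some (⟨a, ha⟩, ⟨k, hk⟩)) = none := by
  subst h; simp [extendAct, h'.ne]

theorem extendAct_last (ha : m < m + 1) (hk : k < e + 1) (h : k < e) :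
    extendAct m e f m (y, some (⟨m, ha⟩, ⟨k, hk⟩)) =
      some (y, some (⟨m, ha⟩, ⟨k + 1, by omega⟩)) := by
  simp [extendAct, h]

theorem extendAct_last_top (ha : m < m + 1) (hk : k < e + 1) (h : e ≤ k) :
    extendAct m e f m (y, some (⟨m, ha⟩, ⟨k, hk⟩)) = none := by
  simp [extendAct, h]

theorem extendAct_gt (ha : a < m + 1) (hk : k < e + 1) (h : a < i) (h' : i < m ∨ k = 0) :
    extendAct m e f i (y, some (⟨a, ha⟩, ⟨k, hk⟩)) =
      (f (i - 1) y).map (·, some (⟨a, ha⟩, ⟨k, hk⟩)) := by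
  have h1 : ¬ i + 1 < a := by omega
  have h2 : ¬ i + 1 = a := by omega
  have h3 : ¬ i = a := by omega
  have h4 : ¬ (i = m ∧ 0 < k) := by omega
  simp only [extendAct, h1, h2, h3, h4, if_false, dif_neg, not_false_eq_true]

theorem extendAct_gt_last (ha : a < m + 1) (hk : k < e + 1) (h : a < m) (h' : 0 < k) :
    extendAct m e f m (y, some (⟨a, ha⟩, ⟨k, hk⟩)) = none := by
  have h1 : ¬ m + 1 < a := by omega
  have h2 : ¬ m + 1 = a := by omega
  have h3 : ¬ m = a := by omega
  simp only [extendAct, h1, h2, h3, h', if_false, dif_neg, not_false_eq_true, if_true, and_true]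

theorem extendAct_sq (hf : NilCoxeterAct f m 2) (i : ℕ) (hi : i < m)
    (x : Y × Option (Fin (m + 1) × Fin (e + 1))) :
    (extendAct m e f i x).bind (extendAct m e f i) = none := by
  have hsq : ∀ i < m, ∀ y, (f i y).bind (f i) = none := by
    intro i hi y
    rcases Nat.lt_or_ge (i + 1) m with h | h
    · exact hf.sq i h y
    · simpa using hf.last i (by omega) y
  obtain ⟨y, _ | ⟨⟨a, ha⟩, ⟨k, hk⟩⟩⟩ := x
  · simp (disch := omega) only [extendAct_none_lt, Option.bind_map, Function.comp_def,
      bind_map_eq, hsq, Option.map_none]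
  · rcases lt_trichotomy (i + 1) a with h | h | h
    · simp (disch := omega) only [extendAct_lt, Option.bind_map, Function.comp_def,
        bind_map_eq, hsq, Option.map_none]
    · simp (disch := omega) only [extendAct_pred, extendAct_self, Option.bind_some]
    · rcases Nat.lt_or_ge a i with h' | h'
      · simp (disch := omega) only [extendAct_gt, Option.bind_map, Function.comp_def,
          bind_map_eq, hsq, Option.map_none]
      · simp (disch := omega) only [extendAct_self, Option.bind_none]

theorem extendAct_comm (hf : NilCoxeterAct f m 2) (i j : ℕ) (hij : i + 1 < j) (hj : j < m + 1)
    (x : Y × Option (Fin (m + 1) × Fin (e + 1))) :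
    (extendAct m e f i x).bind (extendAct m e f j) =
      (extendAct m e f j x).bind (extendAct m e f i) := by
  have hc : ∀ i j, i + 1 < j → j < m → ∀ y, (f j y).bind (f i) = (f i y).bind (f j) :=
    fun i j hij hj y => (hf.comm i j hij hj y).symm
  obtain ⟨y, _ | ⟨⟨a, ha⟩, ⟨k, hk⟩⟩⟩ := x
  · rcases Nat.lt_succ_iff_lt_or_eq.1 hj with h | rfl
    · simp (disch := omega) only [extendAct_none_lt, Option.bind_map, Function.comp_def,
        bind_map_eq, hc]
    · simp (disch := omega) only [extendAct_none_lt, extendAct_none_last, Option.bind_map,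
        Function.comp_def, Option.bind_some, extendAct_lt, bind_some_eq]
  · rcases lt_trichotomy (j + 1) a with h | h | h
    · simp (disch := omega) only [extendAct_lt, Option.bind_map, Function.comp_def,
        bind_map_eq, hc]
    · simp (disch := omega) only [extendAct_lt, extendAct_pred, Option.bind_map,
        Function.comp_def, Option.bind_some, bind_some_eq]
    rcases Nat.lt_or_ge a j with h' | h'
    · rcases Nat.lt_succ_iff_lt_or_eq.1 hj with hm | rfl
      · rcases lt_trichotomy (i + 1) a with h1 | h1 | h1
        -- Only `j` is lowered here, and `i + 1 < a < j` keeps `i` and `j - 1` far enough apart for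
        -- `hc`.
        · simp (disch := omega) only [extendAct_lt, extendAct_gt, Option.bind_map,
            Function.comp_def, bind_map_eq, hc]
        · simp (disch := omega) only [extendAct_pred, extendAct_gt, Option.bind_map,
            Function.comp_def, Option.bind_some, bind_some_eq]
        rcases Nat.lt_or_ge a i with h2 | h2
        · simp (disch := omega) only [extendAct_gt, Option.bind_map,
            Function.comp_def, bind_map_eq, hc]
        · simp (disch := omega) only [extendAct_self, extendAct_gt, Option.bind_map,
            Function.comp_def, Option.bind_none, Option.bind_fun_none]
      · rcases Nat.eq_zero_or_pos k with rfl | hk0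
        · rcases lt_trichotomy (i + 1) a with h1 | h1 | h1
          · simp (disch := omega) only [extendAct_lt, extendAct_gt, Option.bind_map,
              Function.comp_def, bind_map_eq, hc]
          · simp (disch := omega) only [extendAct_pred, extendAct_gt, Option.bind_map,
              Function.comp_def, Option.bind_some, bind_some_eq]
          rcases Nat.lt_or_ge a i with h2 | h2
          · simp (disch := omega) only [extendAct_gt, Option.bind_map,
              Function.comp_def, bind_map_eq, hc]
          · simp (disch := omega) only [extendAct_self, extendAct_gt, Option.bind_map,
              Function.comp_def, Option.bind_none, Option.bind_fun_none]
        · rcases lt_trichotomy (i + 1) a with h1 | h1 | h1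
          · simp (disch := omega) only [extendAct_lt, extendAct_gt_last, Option.bind_map,
              Function.comp_def, Option.bind_none, Option.bind_fun_none]
          · simp (disch := omega) only [extendAct_pred, extendAct_gt_last,
              Option.bind_some, Option.bind_none]
          rcases Nat.lt_or_ge a i with h2 | h2
          · simp (disch := omega) only [extendAct_gt, extendAct_gt_last, Option.bind_map,
              Function.comp_def, Option.bind_none, Option.bind_fun_none]
          · simp (disch := omega) only [extendAct_self, extendAct_gt_last, Option.bind_none]
    · obtain rfl : a = j := by omega
      rcases Nat.lt_succ_iff_lt_or_eq.1 hj with hm | rfl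
      · simp (disch := omega) only [extendAct_lt, extendAct_self, Option.bind_map,
          Function.comp_def, Option.bind_none, Option.bind_fun_none]
      rcases Nat.lt_or_ge k e with hke | hke
      · simp (disch := omega) only [extendAct_lt, extendAct_last, Option.bind_map,
          Function.comp_def, Option.bind_some, bind_some_eq]
      · simp (disch := omega) only [extendAct_lt, extendAct_last_top, Option.bind_map,
          Function.comp_def, Option.bind_none, Option.bind_fun_none]

/-- For `a = i` or `a = i + 1` both sides vanish; for `a = i + 2` both change `a` to `i` and apply
`f i` to `y`. For `a > i + 2` it is the braid relation of `f`; for `a < i` it is that relation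
shifted down by one, or zero on both sides. -/
theorem extendAct_braid (hf : NilCoxeterAct f m 2) (i : ℕ) (hi : i + 1 < m + 1)
    (x : Y × Option (Fin (m + 1) × Fin (e + 1))) :
    ((extendAct m e f i x).bind (extendAct m e f (i + 1))).bind (extendAct m e f i) =
      ((extendAct m e f (i + 1) x).bind (extendAct m e f i)).bind
        (extendAct m e f (i + 1)) := by
  have hb : ∀ i, i + 1 < m → ∀ y, ((f i y).bind (f (i + 1))).bind (f i) =
      ((f (i + 1) y).bind (f i)).bind (f (i + 1)) := hf.braid
  obtain ⟨y, _ | ⟨⟨a, ha⟩, ⟨k, hk⟩⟩⟩ := x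
  · rcases Nat.lt_succ_iff_lt_or_eq.1 hi with h | rfl
    · simp (disch := omega) only [extendAct_none_lt, Option.bind_map, Function.comp_def,
        bind_map_eq, hb]
    · simp (disch := omega) only [extendAct_none_lt, extendAct_none_last, Option.bind_map,
        Function.comp_def, Option.bind_some, extendAct_pred, extendAct_gt, bind_some_eq,
        Nat.add_sub_cancel]
  rcases Nat.lt_succ_iff_lt_or_eq.1 hi with hm | rfl
  · rcases lt_trichotomy (i + 2) a with h | h | h
    · simp (disch := omega) only [extendAct_lt, Option.bind_map, Function.comp_def,
        bind_map_eq, hb]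
    · simp (disch := omega) only [extendAct_lt, extendAct_pred, extendAct_gt, Option.bind_map,
        Function.comp_def, Option.bind_some, bind_some_eq, Nat.add_sub_cancel]
    rcases lt_trichotomy (i + 1) a with h | h | h
    · omega
    · simp (disch := omega) only [extendAct_self, extendAct_pred, extendAct_gt, Option.bind_map,
        Function.comp_def, Option.bind_some, Option.bind_none, Option.bind_fun_none]
    rcases lt_trichotomy i a with h | h | h
    · omega
    · simp (disch := omega) only [extendAct_self, extendAct_gt, Option.bind_map,
        Function.comp_def, Option.bind_none, Option.bind_fun_none]
    · obtain ⟨i, rfl⟩ : ∃ j, i = j + 1 := ⟨i - 1, by omega⟩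
      simp (disch := omega) only [extendAct_gt, Option.bind_map,
        Function.comp_def, bind_map_eq, hb, Nat.add_sub_cancel]
  · rcases lt_trichotomy (i + 1) a with h | h | h
    · omega
    · subst h
      rcases Nat.lt_or_ge k e with hke | hke <;> rcases Nat.eq_zero_or_pos k with rfl | hk0 <;>
        simp (disch := omega) only [extendAct_self, extendAct_pred, extendAct_gt,
          extendAct_gt_last, extendAct_last, extendAct_last_top, Option.bind_map,
          Function.comp_def, Option.bind_some, Option.bind_none, Option.bind_fun_none]
    rcases lt_trichotomy i a with h | h | h
    · omega
    · rcases Nat.eq_zero_or_pos k with rfl | hk0 <;>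
        simp (disch := omega) only [extendAct_self, extendAct_gt, extendAct_gt_last,
          Option.bind_map, Function.comp_def, Option.bind_none, Option.bind_fun_none]
    · obtain ⟨i, rfl⟩ : ∃ j, i = j + 1 := ⟨i - 1, by omega⟩
      rcases Nat.eq_zero_or_pos k with rfl | hk0 <;>
        simp (disch := omega) only [extendAct_gt, extendAct_gt_last, Option.bind_map,
          Function.comp_def, bind_map_eq, hb, Nat.add_sub_cancel, Option.bind_none,
          Option.bind_fun_none]

theorem iterate_extendAct_last (r : ℕ) (hk : k < e + 1) (h : e ≤ k + r) :
    (fun o : Option (Y × Option (Fin (m + 1) × Fin (e + 1))) => o.bind (extendAct m e f m))^[r + 1]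
      (some (y, some (⟨m, by omega⟩, ⟨k, hk⟩))) = none := by
  induction r generalizing k with
  | zero => simp (disch := omega) [extendAct_last_top]
  | succ r ih =>
    rw [Function.iterate_succ_apply, Option.bind_some]
    rcases Nat.lt_or_ge k e with hke | hke
    · rw [extendAct_last _ _ _ hke]
      exact ih _ (by omega)
    · rw [extendAct_last_top _ _ _ hke]
      exact Function.iterate_fixed rfl _

theorem NilCoxeterAct.extend (hf : NilCoxeterAct f m 2) :
    NilCoxeterAct (extendAct m e f) (m + 1) (e + 2) where
  braid := extendAct_braid hf
  comm := extendAct_comm hf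
  sq i hi := extendAct_sq hf i (by omega)
  last i hi x := by
    obtain rfl : i = m := by omega
    obtain ⟨y, _ | ⟨⟨a, ha⟩, ⟨k, hk⟩⟩⟩ := x
    · rw [Function.iterate_succ_apply, Option.bind_some, extendAct_none_last]
      -- One application created the first power of `t m`; the other `e + 1` exhaust the exponents.
      exact iterate_extendAct_last y e _ (by omega)
    rcases Nat.lt_succ_iff_lt_or_eq.1 ha with h | rfl
    -- Below the top position two applications suffice: for `k = 0` they act through the square of
    -- `f (i - 1)`, and for `k > 0` the first one is already zero.
    · have : (extendAct i e f i (y, some (⟨a, ha⟩, ⟨k, hk⟩))).bind (extendAct i e f i) = none := by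
        rcases Nat.eq_zero_or_pos k with rfl | hk0
        · have := hf.last (i - 1) (by omega) y
          rw [Function.iterate_succ_apply, Function.iterate_one, Option.bind_some] at this
          simp (disch := omega) only [extendAct_gt, Option.bind_map, Function.comp_def,
            bind_map_eq, this, Option.map_none]
        · simp (disch := omega) only [extendAct_gt_last, Option.bind_none]
      rw [Function.iterate_succ_apply, Function.iterate_succ_apply, Option.bind_some, this]
      exact Function.iterate_fixed rfl _
    · exact iterate_extendAct_last y _ _ (by omega)

end Extend

/-! ### Recursive construction of normal forms -/

/-- A system of normal forms for the words in the generators `t 0, …, t (n - 1)` of a monoid with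
zero: each generator maps a normal form to zero or to a normal form of length one more. -/
structure NormalForms {R : Type*} [MonoidWithZero R] (t : ℕ → R) (n d : ℕ) where
  /-- The type of normal forms. -/
  X : Type
  fintype : Fintype X
  /-- Left multiplication by the generators, `none` standing for zero. -/
  act : ℕ → X → Option X
  rel : NilCoxeterAct act n d
  /-- The empty normal form. -/
  base : X
  /-- The value of a normal form. -/
  word : X → R
  /-- The length of a normal form. -/
  len : X → ℕ
  word_base : word base = 1
  len_base : len base = 0
  reach : ∀ x, x = base ∨ ∃ i < n, ∃ x', act i x' = some x
  len_act : ∀ i < n, ∀ x x', act i x = some x' → len x' = len x + 1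
  mul_word : ∀ i < n, ∀ x, t i * word x = (act i x).elim 0 word
  sum_len : ∑ x, (Polynomial.X : Polynomial ℤ) ^ len x =
    qFact n * (1 + Polynomial.X * qInt n * qInt (d - 1))

namespace NormalForms

variable {R : Type*} [MonoidWithZero R] {t : ℕ → R} {m e : ℕ}

/-- The normal forms for no generators. -/
def empty (t : ℕ → R) (d : ℕ) : NormalForms t 0 d where
  X := Unit
  fintype := inferInstance
  act _ _ := none
  rel := ⟨by simp, by simp, by simp, by simp⟩
  base := ()
  word _ := 1
  len _ := 0
  word_base := rfl
  len_base := rfl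
  reach _ := Or.inl rfl
  len_act := by simp
  mul_word := by simp
  sum_len := by simp [qFact, qInt]

-- The formal rule `extendAct` agrees with multiplication in any monoid with zero satisfying the
-- relations; this gives spanning.
open NilCoxeterSeq in
theorem mul_word_extend (h : NilCoxeterSeq t (m + 1) (e + 2)) (N : NormalForms t m 2) (i : ℕ)
    (hi : i < m + 1) (x : N.X × Option (Fin (m + 1) × Fin (e + 1))) (w)
    (hw : w = fun x : N.X × Option (Fin (m + 1) × Fin (e + 1)) => x.2.elim (N.word x.1)
      fun p => asc t p.1 m * (t m ^ (p.2 + 1 : ℕ) * N.word x.1)) :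
    t i * w x = (extendAct m e N.act i x).elim 0 w := by
  have w0 : ∀ y, w (y, none) = N.word y := fun y => by rw [hw]; rfl
  have w1 : ∀ y a ha k hk, w (y, some (⟨a, ha⟩, ⟨k, hk⟩)) =
    asc t a m * (t m ^ (k + 1) * N.word y) := fun y a ha k hk => by rw [hw]; rfl
  have wmap : ∀ i < m, ∀ y s c, (∀ y, w (y, s) = c * N.word y) →
      ((N.act i y).map (·, s)).elim 0 w = c * (t i * N.word y) := by
    intro i hi y s c hc
    rw [N.mul_word i hi]
    cases N.act i y with
    | none => simp
    | some y' => simp [hc]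
  clear hw
  obtain ⟨y, _ | ⟨⟨a, ha⟩, ⟨k, hk⟩⟩⟩ := x
  · rcases Nat.lt_succ_iff_lt_or_eq.1 hi with h' | rfl
    · rw [extendAct_none_lt _ h', wmap i h' y none 1 (by simp [w0]), w0, one_mul]
    · simp [extendAct_none_last, w1, w0, asc_self]
  have w1' : ∀ y, w (y, some (⟨a, ha⟩, ⟨k, hk⟩)) = asc t a m * t m ^ (k + 1) * N.word y :=
    fun y => by rw [w1, mul_assoc]
  rcases lt_trichotomy (i + 1) a with h1 | h1 | h1
  · rw [extendAct_lt _ _ _ h1, wmap i (by omega) _ _ _ w1', w1', ← mul_assoc, ← mul_assoc,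
      ← mul_assoc, (h.commute_asc hi (by omega) (Or.inl h1)).eq, mul_assoc _ (t i),
      ((h.commute hi (by omega) (Or.inl (by omega)) : Commute (t i) (t m)).pow_right _).eq,
      ← mul_assoc]
  · subst h1
    rw [extendAct_pred _ _ _ rfl, Option.elim_some, w1, w1, ← mul_assoc,
      ← asc_eq_mul (by omega)]
  rcases Nat.lt_or_ge a i with h2 | h2
  · rcases Nat.lt_succ_iff_lt_or_eq.1 hi with h3 | rfl
    · rw [extendAct_gt _ _ _ h2 (Or.inl h3), wmap _ (by omega) _ _ _ w1', w1', ← mul_assoc,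
        ← mul_assoc, ← mul_assoc, h.mul_asc_of_mem h2 h3 (by omega), mul_assoc _ (t (i - 1)),
        ((h.commute (by omega) (by omega) (Or.inl (by omega)) :
          Commute (t (i - 1)) (t m)).pow_right _).eq, ← mul_assoc]
    · obtain ⟨i, rfl⟩ : ∃ j, i = j + 1 := ⟨i - 1, by omega⟩
      have c := h.commute_asc (i := i + 1) (a := a) (b := i) hi (by omega) (by omega)
      have br := h.braid i (by omega)
      have key : t (i + 1) * (asc t a (i + 1) * t (i + 1)) = asc t a (i + 1) * (t (i + 1) * t i) := by
        rw [asc_succ (by omega)]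
        calc _ = (t (i + 1) * asc t a i) * (t i * t (i + 1)) := by simp only [mul_assoc]
          _ = asc t a i * (t (i + 1) * (t i * t (i + 1))) := by rw [c.eq, mul_assoc]
          _ = _ := by rw [← br]; simp only [mul_assoc]
      rcases Nat.eq_zero_or_pos k with rfl | hk0
      · rw [extendAct_gt _ _ _ h2 (Or.inr rfl), wmap _ (by omega) _ _ _ w1', w1', zero_add,
          pow_one, ← mul_assoc, key, Nat.add_sub_cancel]
        simp only [mul_assoc]
      · obtain ⟨k, rfl⟩ : ∃ j, k = j + 1 := ⟨k - 1, by omega⟩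
        rw [extendAct_gt_last _ _ _ h2 hk0, Option.elim_none, w1']
        -- After `key`, the second factor `t (i + 1)` allows another braid move, which exposes `t i
        -- * t i`.
        calc _ = (t (i + 1) * (asc t a (i + 1) * t (i + 1))) * (t (i + 1) * (t (i + 1) ^ k * N.word y)) := by
              simp only [mul_assoc, pow_succ']
          _ = asc t a i * t i * (t (i + 1) * (t i * t (i + 1)) * (t (i + 1) ^ k * N.word y)) := by
              rw [key, asc_succ (by omega)]; simp only [mul_assoc]
          _ = asc t a i * (t i * t i * (t (i + 1) * t i * (t (i + 1) ^ k * N.word y))) := by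
              rw [← br]; simp only [mul_assoc]
          _ = 0 := by rw [h.sq i (by omega), zero_mul, mul_zero]
  obtain rfl : i = a := by omega
  rcases Nat.lt_succ_iff_lt_or_eq.1 hi with h3 | rfl
  · rw [extendAct_self _ _ _ rfl h3, w1, ← mul_assoc, mul_asc_self h h3 (by omega), zero_mul,
      Option.elim_none]
  · rcases Nat.lt_or_ge k e with hke | hke
    · rw [extendAct_last _ _ _ hke, Option.elim_some, w1, w1, asc_self, one_mul, one_mul,
        pow_succ' _ (k + 1), mul_assoc]
    · obtain rfl : k = e := by omega
      rw [extendAct_last_top _ _ _ hke, Option.elim_none, w1, asc_self, one_mul, ← mul_assoc,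
        ← pow_succ', h.last i rfl, zero_mul]

theorem sum_len_extend (N : NormalForms t m 2) [Fintype N.X] :
    ∑ x : N.X × Option (Fin (m + 1) × Fin (e + 1)), (Polynomial.X : Polynomial ℤ) ^
      (N.len x.1 + x.2.elim 0 fun p => m - p.1 + (p.2 + 1)) =
    qFact (m + 1) * (1 + Polynomial.X * qInt (m + 1) * qInt (e + 2 - 1)) := by
  have hN := N.sum_len
  have e1 : qFact (m + 1) = qFact m * qInt (m + 1) := by
    rw [qFact, Finset.prod_Icc_succ_top (by omega), qFact]
  have e2 : qInt (m + 1) = 1 + Polynomial.X * qInt m := by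
    simp [qInt, Finset.sum_range_succ', Finset.mul_sum, pow_succ', add_comm]
  have e3 : ∀ j, ∑ a : Fin (j + 1), (Polynomial.X : Polynomial ℤ) ^ (j - a : ℕ) =
      qInt (j + 1) := by
    intro j
    rw [Fin.sum_univ_eq_sum_range (fun a => (Polynomial.X : Polynomial ℤ) ^ (j - a)), qInt,
      ← Finset.sum_range_reflect]
    refine Finset.sum_congr rfl fun i hi => ?_
    have := Finset.mem_range.1 hi
    congr 1
    omega
  have e4 : ∑ k : Fin (e + 1), (Polynomial.X : Polynomial ℤ) ^ (k + 1 : ℕ) =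
      Polynomial.X * qInt (e + 1) := by
    rw [Fin.sum_univ_eq_sum_range (fun k => (Polynomial.X : Polynomial ℤ) ^ (k + 1)), qInt,
      Finset.mul_sum]
    simp only [pow_succ']
  -- The previous stage has exponent 2, so its length sum collapses to `qFact (m + 1)`.
  have e5 : qInt (2 - 1) = 1 := by simp [qInt]
  rw [e5, mul_one, ← e2, ← e1] at hN
  rw [Fintype.sum_prod_type]
  simp only [pow_add _ (N.len _), ← Finset.mul_sum, ← Finset.sum_mul]
  rw [show ∑ x, (Polynomial.X : Polynomial ℤ) ^ N.len x = qFact (m + 1) by convert hN,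
    Fintype.sum_option, Fintype.sum_prod_type]
  simp only [Option.elim_none, Option.elim_some, pow_zero, pow_add _ (m - _),
    ← Finset.mul_sum, ← Finset.sum_mul]
  rw [e4, e3]
  simp only [show e + 2 - 1 = e + 1 from rfl]
  ring

/-- Normal forms for one more generator. -/
noncomputable def extend (h : NilCoxeterSeq t (m + 1) (e + 2)) (N : NormalForms t m 2) :
    NormalForms t (m + 1) (e + 2) :=
  letI := N.fintype
  { X := N.X × Option (Fin (m + 1) × Fin (e + 1))
    fintype := inferInstance
    act := extendAct m e N.act
    rel := N.rel.extend
    base := (N.base, none)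
    word := fun x => x.2.elim (N.word x.1)
      fun p => NilCoxeterSeq.asc t p.1 m * (t m ^ (p.2 + 1 : ℕ) * N.word x.1)
    len := fun x => N.len x.1 + x.2.elim 0 fun p => m - p.1 + (p.2 + 1)
    word_base := N.word_base
    len_base := N.len_base
    mul_word := fun i hi x => mul_word_extend h N i hi x _ rfl
    sum_len := sum_len_extend N
    reach := by
      rintro ⟨y, _ | ⟨⟨a, ha⟩, ⟨k, hk⟩⟩⟩
      · rcases N.reach y with rfl | ⟨i, hi, y', hy⟩
        · exact Or.inl rfl
        · exact Or.inr ⟨i, by omega, (y', none), by simp [extendAct_none_lt, hi, hy]⟩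
      · rcases Nat.lt_succ_iff_lt_or_eq.1 ha with h | rfl
        · exact Or.inr ⟨a, by omega, (y, some (⟨a + 1, by omega⟩, ⟨k, hk⟩)),
            extendAct_pred y _ _ rfl⟩
        rcases k with _ | k
        · exact Or.inr ⟨a, by omega, (y, none), extendAct_none_last y⟩
        · exact Or.inr ⟨a, by omega, (y, some (⟨a, ha⟩, ⟨k, by omega⟩)),
            extendAct_last y _ _ (by omega)⟩
    len_act := by
      have hmap : ∀ i < m, ∀ y (s : Option (Fin (m + 1) × Fin (e + 1))) x',
          (N.act i y).map (·, s) = some x' →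
          x'.2 = s ∧ N.len x'.1 = N.len y + 1 := by
        intro i hi y s x' hx
        obtain ⟨y', hy, rfl⟩ := Option.map_eq_some_iff.1 hx
        exact ⟨rfl, N.len_act i hi y y' hy⟩
      rintro i hi ⟨y, _ | ⟨⟨a, ha⟩, ⟨k, hk⟩⟩⟩ x' hx
      · rcases Nat.lt_succ_iff_lt_or_eq.1 hi with h' | rfl
        · rw [extendAct_none_lt _ h'] at hx
          obtain ⟨h1, h2⟩ := hmap i h' _ _ _ hx
          simp [h1, h2]
        · rw [extendAct_none_last, Option.some_inj] at hx
          subst hx; simp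
      have hmap' : ∀ i < m, (N.act i y).map (·, some (⟨a, ha⟩, ⟨k, hk⟩)) = some x' →
          (N.len x'.1 + x'.2.elim 0 fun p => m - p.1 + (p.2 + 1)) =
            N.len y + (m - a + (k + 1)) + 1 := by
        intro i hi hx
        obtain ⟨h1, h2⟩ := hmap i hi _ _ _ hx
        rw [h1, h2, Option.elim_some]; ring
      rcases lt_trichotomy (i + 1) a with h1 | h1 | h1
      · rw [extendAct_lt _ _ _ h1] at hx
        exact hmap' i (by omega) hx
      · rw [extendAct_pred _ _ _ h1, Option.some_inj] at hx
        subst hx; simp only [Option.elim_some]; omega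
      rcases Nat.lt_or_ge a i with h2 | h2
      · by_cases h3 : i < m ∨ k = 0
        · rw [extendAct_gt _ _ _ h2 h3] at hx
          exact hmap' _ (by omega) hx
        · obtain rfl : i = m := by omega
          rw [extendAct_gt_last _ _ _ h2 (by omega)] at hx
          cases hx
      obtain rfl : i = a := by omega
      rcases Nat.lt_succ_iff_lt_or_eq.1 hi with h3 | rfl
      · rw [extendAct_self _ _ _ rfl h3] at hx
        cases hx
      rcases Nat.lt_or_ge k e with hke | hke
      · rw [extendAct_last _ _ _ hke, Option.some_inj] at hx
        subst hx; simp only [Option.elim_some]; omega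
      · rw [extendAct_last_top _ _ _ hke] at hx
        cases hx }

/-- The monoid and the sequence `t` stay fixed while the range of generators shrinks, so all words
live in the final algebra from the start. -/
theorem nonempty (n e : ℕ) (h : NilCoxeterSeq t n (e + 2)) :
    Nonempty (NormalForms t n (e + 2)) := by
  induction n generalizing e with
  | zero => exact ⟨empty t _⟩
  | succ m ih => exact (ih 0 h.restrict).map (extend h)

end NormalForms

/-! ### Linearisation of partial maps -/

namespace NilCoxeterAct

variable (k : Type*) [Field k] {X : Type} (f : ℕ → X → Option X)

/-- The vector of a normal form, or zero. -/
noncomputable def toFinsupp (o : Option X) : X →₀ k := o.elim 0 (Finsupp.single · 1)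

/-- The linear extension of a partial map. -/
noncomputable def op (i : ℕ) : Module.End k (X →₀ k) :=
  Finsupp.linearCombination k fun x => toFinsupp k (f i x)

theorem op_toFinsupp (i : ℕ) (o : Option X) :
    op k f i (toFinsupp k o) = toFinsupp k (o.bind (f i)) := by
  cases o <;> simp [op, toFinsupp]

theorem op_pow_toFinsupp (i r : ℕ) (o : Option X) :
    (op k f i ^ r) (toFinsupp k o) =
      toFinsupp k ((fun o : Option X => o.bind (f i))^[r] o) := by
  induction r generalizing o with
  | zero => rfl
  | succ r ih => rw [pow_succ, Module.End.mul_apply, op_toFinsupp, ih]; rfl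

theorem end_ext {g h : Module.End k (X →₀ k)}
    (H : ∀ x, g (toFinsupp k (some x)) = h (toFinsupp k (some x))) : g = h :=
  Finsupp.lhom_ext' fun x => LinearMap.ext_ring (H x)

theorem op_seq {f : ℕ → X → Option X} {n d : ℕ} (hf : NilCoxeterAct f n d) :
    NilCoxeterSeq (op k f) n d where
  braid i hi := end_ext k fun x => by
    simpa only [Module.End.mul_apply, op_toFinsupp, Option.bind_some] using
      congrArg (toFinsupp k) (hf.braid i hi x)
  -- `bind` composes left to right and operators right to left, hence the `symm`.
  comm i j hij hj := end_ext k fun x => by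
    simpa only [Module.End.mul_apply, op_toFinsupp, Option.bind_some] using
      congrArg (toFinsupp k) (hf.comm i j hij hj x).symm
  sq i hi := end_ext k fun x => by
    rw [Module.End.mul_apply, op_toFinsupp, op_toFinsupp, Option.bind_some, hf.sq i hi x]
    rfl
  last i hi := end_ext k fun x => by
    rw [op_pow_toFinsupp, hf.last i hi x]
    rfl

end NilCoxeterAct

/-! ### The algebra and its degree parts -/

namespace NilCoxeterA

section Generators

variable (k : Type*) [Field k] (n d : ℕ)

/-- The generators of `NC_A(n,d)` as a sequence, extended by zero. -/
noncomputable def seqT (i : ℕ) : NilCoxeterA k n d := if h : i < n then T k n d ⟨i, h⟩ else 0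

theorem seqT_of_lt {i : ℕ} (h : i < n) : seqT k n d i = T k n d ⟨i, h⟩ := dif_pos h

theorem seqT_rel : NilCoxeterSeq (seqT k n d) n d where
  braid i hi := by
    have := RingQuot.mkAlgHom_rel k
      (NilCoxeterRel.braid (k := k) (d := d) (⟨i, by omega⟩ : Fin n) ⟨i + 1, hi⟩ rfl)
    rw [seqT_of_lt k n d hi, seqT_of_lt k n d (Nat.lt_of_succ_lt hi)]
    simpa only [T, map_mul, mul_assoc] using this
  comm i j hij hj := by
    have := RingQuot.mkAlgHom_rel k
      (NilCoxeterRel.comm (k := k) (d := d) (⟨i, by omega⟩ : Fin n) ⟨j, hj⟩ hij)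
    rw [seqT_of_lt k n d hj, seqT_of_lt k n d (by omega)]
    simpa only [T, map_mul] using this
  sq i hi := by
    have := RingQuot.mkAlgHom_rel k
      (NilCoxeterRel.sq (k := k) (d := d) (⟨i, by omega⟩ : Fin n) hi)
    rw [seqT_of_lt k n d (by omega), ← pow_two]
    simpa only [T, map_pow, map_zero] using this
  last i hi := by
    have := RingQuot.mkAlgHom_rel k
      (NilCoxeterRel.last (k := k) (d := d) (⟨i, by omega⟩ : Fin n) hi)
    rw [seqT_of_lt k n d (by omega)]
    simpa only [T, map_pow, map_zero] using this

variable {k n d}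

/-- The representation of `NC_A(n,d)` given by elements satisfying its relations. -/
noncomputable def lift {B : Type*} [Semiring B] [Algebra k B] {t : ℕ → B}
    (h : NilCoxeterSeq t n d) : NilCoxeterA k n d →ₐ[k] B :=
  RingQuot.liftAlgHom k ⟨FreeAlgebra.lift k fun i : Fin n => t i, by
    rintro _ _ (⟨i, j, hij⟩ | ⟨i, j, hij⟩ | ⟨i, hi⟩ | ⟨i, hi⟩)
    · simpa [← hij, mul_assoc] using h.braid i (by omega)
    · simpa using h.comm i j hij j.2
    · simpa [pow_two] using h.sq i hi
    · simpa using h.last i hi⟩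

theorem lift_T {B : Type*} [Semiring B] [Algebra k B] {t : ℕ → B}
    (h : NilCoxeterSeq t n d) (i : Fin n) : lift (k := k) h (T k n d i) = t i := by
  simp [lift, T]

theorem one_mem_degreePart : (1 : NilCoxeterA k n d) ∈ degreePart k n d 0 :=
  Submodule.subset_span ⟨[], rfl, rfl⟩

theorem T_mem_degreePart (i : Fin n) : T k n d i ∈ degreePart k n d 1 :=
  Submodule.subset_span ⟨[i], rfl, by simp⟩

theorem mul_mem_degreePart {p q : ℕ} {a b : NilCoxeterA k n d} (ha : a ∈ degreePart k n d p)
    (hb : b ∈ degreePart k n d q) : a * b ∈ degreePart k n d (p + q) := by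
  have h : degreePart k n d p * degreePart k n d q ≤ degreePart k n d (p + q) := by
    rw [degreePart, degreePart, Submodule.span_mul_span]
    refine Submodule.span_mono ?_
    rintro _ ⟨_, ⟨l, rfl, rfl⟩, _, ⟨l', rfl, rfl⟩, rfl⟩
    exact ⟨l ++ l', by simp, by simp⟩
  exact h (Submodule.mul_mem_mul ha hb)

instance gradedMonoid_degreePart : SetLike.GradedMonoid (degreePart k n d) where
  one_mem := one_mem_degreePart
  mul_mem _ _ _ _ := mul_mem_degreePart

/-- The sum of the degree parts contains `1` and is stable under left multiplication by the whole
algebra. -/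
theorem iSup_degreePart : ⨆ m, degreePart k n d m = ⊤ := by
  let S : Submodule k (NilCoxeterA k n d) := ⨆ m, degreePart k n d m
  have key : ∀ a : FreeAlgebra k (Fin n), ∀ s ∈ S,
      RingQuot.mkAlgHom k (NilCoxeterRel k n d) a * s ∈ S := by
    intro a
    induction a using FreeAlgebra.induction with
    | grade0 r =>
      intro s hs
      rw [AlgHom.commutes, ← Algebra.smul_def]
      exact S.smul_mem _ hs
    | grade1 i =>
      intro s hs
      refine Submodule.iSup_induction _ (motive := fun s => T k n d i * s ∈ S) hs ?_ ?_ ?_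
      · intro m x hx
        exact Submodule.mem_iSup_of_mem (1 + m) (mul_mem_degreePart (T_mem_degreePart i) hx)
      · simp
      · intro x y hx hy
        rw [mul_add]; exact S.add_mem hx hy
    | mul a b ha hb =>
      intro s hs
      rw [map_mul, mul_assoc]; exact ha _ (hb _ hs)
    | add a b ha hb =>
      intro s hs
      rw [map_add, add_mul]; exact S.add_mem (ha _ hs) (hb _ hs)
  refine eq_top_iff.2 fun x _ => ?_
  obtain ⟨a, rfl⟩ := RingQuot.mkAlgHom_surjective k (NilCoxeterRel k n d) x
  have := key a 1 (Submodule.mem_iSup_of_mem 0 one_mem_degreePart)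
  rwa [mul_one] at this

end Generators

/-! ### The basis, the grading and the Hilbert series -/

section NormalForms

variable {k : Type*} [Field k] {n d : ℕ} (N : NormalForms (seqT k n d) n d)

theorem normalForms_induction {P : N.X → Prop} (h0 : P N.base)
    (h : ∀ i < n, ∀ x x', N.act i x = some x' → P x → P x') (x : N.X) : P x := by
  induction hl : N.len x using Nat.strong_induction_on generalizing x with
  | _ l ih =>
    rcases N.reach x with rfl | ⟨i, hi, y, hy⟩
    · exact h0
    · have := N.len_act i hi y x hy
      exact h i hi y x hy (ih _ (by omega) y rfl)

theorem mul_word_of_act {i : ℕ} (hi : i < n) {x x' : N.X} (h : N.act i x = some x') :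
    N.word x' = T k n d ⟨i, hi⟩ * N.word x := by
  rw [← seqT_of_lt, N.mul_word i hi, h, Option.elim_some]

theorem word_mem_degreePart (x : N.X) : N.word x ∈ degreePart k n d (N.len x) := by
  refine normalForms_induction N (P := fun x => N.word x ∈ degreePart k n d (N.len x)) ?_ ?_ x
  · rw [N.word_base, N.len_base]; exact one_mem_degreePart
  · intro i hi x x' h hx
    rw [mul_word_of_act N hi h, N.len_act i hi x x' h, add_comm]
    exact mul_mem_degreePart (T_mem_degreePart _) hx

theorem prod_eq_zero_or_word (l : List (Fin n)) :
    (l.map (T k n d)).prod = 0 ∨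
      ∃ x, N.len x = l.length ∧ (l.map (T k n d)).prod = N.word x := by
  induction l with
  | nil => exact Or.inr ⟨N.base, N.len_base, N.word_base.symm⟩
  | cons i l ih =>
    rw [List.map_cons, List.prod_cons]
    rcases ih with h | ⟨x, hx, h⟩
    · exact Or.inl (by rw [h, mul_zero])
    rw [h, ← seqT_of_lt k n d i.2, N.mul_word i i.2]
    cases hy : N.act i x with
    | none => exact Or.inl rfl
    | some y => exact Or.inr ⟨y, by rw [N.len_act i i.2 x y hy, hx, List.length_cons], rfl⟩

theorem degreePart_eq_span_word (m : ℕ) :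
    degreePart k n d m = Submodule.span k (N.word '' {x | N.len x = m}) := by
  refine le_antisymm (Submodule.span_le.2 ?_) (Submodule.span_le.2 ?_)
  · rintro _ ⟨l, rfl, rfl⟩
    rcases prod_eq_zero_or_word N l with h | ⟨x, hx, h⟩
    · rw [h]; exact Submodule.zero_mem _
    · rw [h]; exact Submodule.subset_span ⟨x, hx, rfl⟩
  · rintro _ ⟨x, rfl, rfl⟩
    exact word_mem_degreePart N x

theorem linearIndependent_word : LinearIndependent k N.word := by
  -- `φ` is evaluation of the representation at the base vector.
  let φ : NilCoxeterA k n d →ₗ[k] (N.X →₀ k) :=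
    { toFun := fun a => lift (NilCoxeterAct.op_seq k N.rel) a (Finsupp.single N.base 1)
      map_add' := fun a b => by rw [map_add, LinearMap.add_apply]
      map_smul' := fun c a => by rw [map_smul, LinearMap.smul_apply, RingHom.id_apply] }
  refine LinearIndependent.of_comp φ ?_
  have : φ ∘ N.word = fun x => Finsupp.single x (1 : k) := by
    funext x
    refine normalForms_induction N (P := fun x => φ (N.word x) = Finsupp.single x 1) ?_ ?_ x
    · simp [φ, N.word_base]
    · intro i hi x x' h hx
      have e := NilCoxeterAct.op_toFinsupp k N.act i (some x)
      rw [Option.bind_some, h] at e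
      change lift (NilCoxeterAct.op_seq k N.rel) (N.word x) (Finsupp.single N.base 1) = _ at hx
      change lift (NilCoxeterAct.op_seq k N.rel) (N.word x') (Finsupp.single N.base 1) = _
      rw [mul_word_of_act N hi h, map_mul, lift_T, Module.End.mul_apply, hx]
      exact e
  rw [this]
  exact Finsupp.linearIndependent_single_one k N.X

/-- Distinct degrees use disjoint subsets of a linearly independent family. -/
theorem isInternal_degreePart (N : NormalForms (seqT k n d) n d) : DirectSum.IsInternal (degreePart k n d) := by
  refine DirectSum.isInternal_submodule_of_iSupIndep_of_iSup_eq_top (fun m => ?_)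
    iSup_degreePart
  have hd : Disjoint {x | N.len x = m} {x | N.len x ≠ m} :=
    Set.disjoint_left.2 fun x h h' => h' h
  refine ((linearIndependent_word N).disjoint_span_image hd).mono
    (degreePart_eq_span_word N m).le (iSup₂_le fun j hj => ?_)
  rw [degreePart_eq_span_word N j]
  exact Submodule.span_mono (Set.image_mono fun x hx => fun h => hj (hx.symm.trans h))

theorem finite_degreePart (N : NormalForms (seqT k n d) n d) (m : ℕ) : Module.Finite k (degreePart k n d m) := by
  have := N.fintype
  rw [degreePart_eq_span_word N m]
  exact Module.Finite.span_of_finite k (Set.toFinite _)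

theorem finrank_degreePart [Fintype N.X] (m : ℕ) :
    Module.finrank k (degreePart k n d m) = (Finset.univ.filter fun x => N.len x = m).card := by
  rw [degreePart_eq_span_word N m, ← Fintype.card_subtype, Set.image_eq_range]
  exact finrank_span_eq_card ((linearIndependent_word N).comp _ Subtype.val_injective)

theorem hilbertPoincareSeries_degreePart (N : NormalForms (seqT k n d) n d) :
    hilbertPoincareSeries (degreePart k n d) =
      ((qFact n * (1 + Polynomial.X * qInt n * qInt (d - 1)) : Polynomial ℤ) : ℤ⟦X⟧) := by
  let := N.fintype
  rw [← N.sum_len]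
  ext m
  rw [hilbertPoincareSeries, PowerSeries.coeff_mk, finrank_degreePart N, Polynomial.coeff_coe,
    Polynomial.finsetSum_coeff, Finset.card_filter, Nat.cast_sum]
  refine Finset.sum_congr rfl fun x _ => ?_
  simp [Polynomial.coeff_X_pow, eq_comm]

end NormalForms

end NilCoxeterA

theorem mainTheorem7 {k : Type*} [Field k] (n d : ℕ) (hn : 1 ≤ n) (hd : 2 ≤ d) :
    (∀ i : Fin n, NilCoxeterA.T k n d i ∈ NilCoxeterA.degreePart k n d 1) ∧
    SetLike.GradedMonoid (NilCoxeterA.degreePart k n d) ∧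
    DirectSum.IsInternal (NilCoxeterA.degreePart k n d) ∧
    (∀ m : ℕ, Module.Finite k (NilCoxeterA.degreePart k n d m)) ∧
    hilbertPoincareSeries (NilCoxeterA.degreePart k n d) =
      ((qFact n * (1 + Polynomial.X * qInt n * qInt (d - 1)) : Polynomial ℤ) : ℤ⟦X⟧) := by
  obtain ⟨e, rfl⟩ : ∃ e, d = e + 2 := ⟨d - 2, by omega⟩
  obtain ⟨N⟩ := NormalForms.nonempty n e (NilCoxeterA.seqT_rel k n (e + 2))
  exact ⟨NilCoxeterA.T_mem_degreePart, NilCoxeterA.gradedMonoid_degreePart,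
    NilCoxeterA.isInternal_degreePart N, NilCoxeterA.finite_degreePart N,
    NilCoxeterA.hilbertPoincareSeries_degreePart N⟩
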